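/- Let $A\in\mathbb R^{n\times n}$ be symmetric positive definite with smallest eigenvalue $\lambda_{\min}\ge 1$ and largest eigenvalue $\lambda_{\max}$. Let $f=\log$, let $f(A)=Uf(\Lambda)U^T$ for an orthogonal eigendecomposition $A=U\Lambda U^T$, let $Q\in\mathbb R^{n\times k}$ have orthonormal columns, and put $$\Delta=(I-QQ^T)f(A)(I-QQ^T).$$ Let $z^{(1)},\dots,z^{(N)}\in\{-1,1\}^n$, $N\ge 1$ (any realization of $N$ Rademacher query vectors), let $w^{(i)}=(I-QQ^T)z^{(i)}$ and $v^{(i)}=w^{(i)}/\|w^{(i)}\|_2$, and put $$H^N(\Delta)=\frac1N\sum_{i=1}^N (z^{(i)})^T\Delta z^{(i)},\qquad L^N_{m+1}(\Delta)=\frac1N\sum_{i=1}^N\|w^{(i)}\|_2^2\sum_{l}\tau^{(i)}_l f(\theta^{(i)}_l).$$ Here $\theta^{(i)}_l$ are the eigenvalues of the Jacobi matrix $T^{(i)}$ produced by $m+1$ steps of the Lanczos algorithm for $A$ with starting vector $v^{(i)}$, and $\tau^{(i)}_l=(e_1^Ty^{(i)}_l)^2$ for a corresponding orthonormal basis of eigenvectors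 $y^{(i)}_l$ of $T^{(i)}$. If the algorithm terminates after fewer steps because an off-diagonal coefficient vanishes, $T^{(i)}$ is the smaller Jacobi matrix obtained at that point. Terms with $w^{(i)}=0$ are $0$. Let $\varepsilon>0$ and $$C=(n-1)f(\lambda_{\min})+f(\lambda_{\max}),\qquad M_\rho=\left|\log\frac{\lambda_{\min}}2\right|+\pi,\qquad \rho=\frac{\lambda_{\max}+\sqrt{2\lambda_{\max}\lambda_{\min}-\lambda_{\min}^2}}{\lambda_{\max}-\lambda_{\min}}.$$ If the integer $m\ge 0$ satisfies $$m\ \ge\ \frac12\,\log\!\left(\frac{16\,n\,M_\rho}{C\,\varepsilon\,(\rho^2-\rho)}\right)\Big/\log\rho$$ (no condition on $m$ is imposed when $\lambda_{\min}=\lambda_{\max}$), then $$\left|H^N(\Delta)-L^N_{m+1}(\Delta)\right|\ \le\ \frac{\varepsilon}{4}\,\left|\operatorname{tr} f(A)\right|.$$ -/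

import Mathlib

open scoped Matrix

namespace SLQ

noncomputable section

/-- The Euclidean norm of a real vector. -/
def norm2 {n : ℕ} (x : Fin n → ℝ) : ℝ := ‖WithLp.toLp 2 x‖

/-- The data carried from one Lanczos step to the next: the previous Lanczos vector, the current
one, and the coefficient that couples them. -/
structure LanczosState (n : ℕ) where
  prev : Fin n → ℝ
  cur : Fin n → ℝ
  coupling : ℝ

/-- The diagonal coefficient `qᵀ A q` of a state with current vector `q`. -/
def LanczosState.diag {n : ℕ} (A : Matrix (Fin n) (Fin n) ℝ) (s : LanczosState n) : ℝ :=
  s.cur ⬝ᵥ (A *ᵥ s.cur)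

/-- The unnormalized next vector `A q - (qᵀ A q) q - β p` of a state with current vector `q`,
previous vector `p` and coupling `β`. -/
def LanczosState.residual {n : ℕ} (A : Matrix (Fin n) (Fin n) ℝ) (s : LanczosState n) :
    Fin n → ℝ :=
  A *ᵥ s.cur - s.diag A • s.cur - s.coupling • s.prev

/-- The Lanczos iteration for the symmetric matrix `A` with unit starting vector `v`. -/
def lanczosState {n : ℕ} (A : Matrix (Fin n) (Fin n) ℝ) (v : Fin n → ℝ) : ℕ → LanczosState n
  | 0 => ⟨0, v, 0⟩
  | k + 1 =>
    let s := lanczosState A v k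
    ⟨s.cur, (norm2 (s.residual A))⁻¹ • s.residual A, norm2 (s.residual A)⟩

/-- The diagonal Lanczos coefficients `α₀, α₁, …`. -/
def lanczosAlpha {n : ℕ} (A : Matrix (Fin n) (Fin n) ℝ) (v : Fin n → ℝ) (k : ℕ) : ℝ :=
  (lanczosState A v k).diag A

/-- The off-diagonal Lanczos coefficients `β₀, β₁, …`; `β_k` couples the vectors `q_k` and
`q_{k+1}`. -/
def lanczosBeta {n : ℕ} (A : Matrix (Fin n) (Fin n) ℝ) (v : Fin n → ℝ) (k : ℕ) : ℝ :=
  norm2 ((lanczosState A v k).residual A)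

/-- The index of the last Lanczos vector that the `(m+1)`-step Lanczos algorithm computes: it is
`m`, unless the algorithm terminates earlier because some `β_j` with `j < m` vanishes, and then
it is the first such `j`. -/
def lanczosLast {n : ℕ} (A : Matrix (Fin n) (Fin n) ℝ) (v : Fin n → ℝ) (m : ℕ) : ℕ :=
  sInf {j : ℕ | j = m ∨ lanczosBeta A v j = 0}

/-- The symmetric tridiagonal matrix of size `j + 1` with diagonal `α₀, …, α_j` and off-diagonal
`β₀, …, β_{j-1}`. -/
def jacobiMatrix (α β : ℕ → ℝ) (j : ℕ) : Matrix (Fin (j + 1)) (Fin (j + 1)) ℝ :=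
  Matrix.of fun a b =>
    if (a : ℕ) = b then α a
    else if (a : ℕ) + 1 = b then β a
    else if (b : ℕ) + 1 = a then β b
    else 0

theorem jacobiMatrix_isHermitian (α β : ℕ → ℝ) (j : ℕ) : (jacobiMatrix α β j).IsHermitian := by
  ext a b
  simp only [Matrix.conjTranspose_apply, star_trivial, jacobiMatrix, Matrix.of_apply]
  grind

/-- The quadrature sum `∑_k τ_k f(θ_k)` attached to a Jacobi matrix: `θ_k` are its eigenvalues,
and `τ_k` is the square of the first entry of the corresponding unit eigenvector. -/
def jacobiQuadrature (f : ℝ → ℝ) (α β : ℕ → ℝ) (j : ℕ) : ℝ :=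
  ∑ k : Fin (j + 1),
    ((jacobiMatrix_isHermitian α β j).eigenvectorBasis k 0) ^ 2 *
      f ((jacobiMatrix_isHermitian α β j).eigenvalues k)

/-- The `(m+1)`-step Lanczos quadrature approximation of `vᵀ f(A) v`, for a unit vector `v`. -/
def lanczosQuadrature {n : ℕ} (f : ℝ → ℝ) (A : Matrix (Fin n) (Fin n) ℝ) (v : Fin n → ℝ)
    (m : ℕ) : ℝ :=
  jacobiQuadrature f (lanczosAlpha A v) (lanczosBeta A v) (lanczosLast A v m)

/-- The matrix function `f(A) = U f(Λ) Uᵀ` of a symmetric matrix `A = U Λ Uᵀ`. -/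
def matFun {n : ℕ} (f : ℝ → ℝ) {A : Matrix (Fin n) (Fin n) ℝ} (hA : A.IsHermitian) :
    Matrix (Fin n) (Fin n) ℝ :=
  hA.cfc f

/-- The projector `I - Q Qᵀ`. -/
def compl {n k : ℕ} (Q : Matrix (Fin n) (Fin k) ℝ) : Matrix (Fin n) (Fin n) ℝ := 1 - Q * Qᵀ

/-- The matrix `Δ = (I - Q Qᵀ) f(A) (I - Q Qᵀ)`. -/
def Delta {n k : ℕ} (f : ℝ → ℝ) {A : Matrix (Fin n) (Fin n) ℝ} (hA : A.IsHermitian)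
    (Q : Matrix (Fin n) (Fin k) ℝ) : Matrix (Fin n) (Fin n) ℝ :=
  compl Q * matFun f hA * compl Q

/-- The Hutchinson estimator `(1/N) ∑ᵢ zᵢᵀ B zᵢ` of the trace of `B`. -/
def hutchinson {n N : ℕ} (B : Matrix (Fin n) (Fin n) ℝ) (z : Fin N → Fin n → ℝ) : ℝ :=
  (1 / (N : ℝ)) * ∑ i, z i ⬝ᵥ (B *ᵥ z i)

/-- The stochastic Lanczos quadrature estimator
`(1/N) ∑ᵢ ‖(I - Q Qᵀ) zᵢ‖² ∑_k τ_k⁽ⁱ⁾ f(θ_k⁽ⁱ⁾)`, in which the inner sums are the `(m+1)`-step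
Lanczos quadratures for `A` with starting vectors `vᵢ = (I - Q Qᵀ) zᵢ / ‖(I - Q Qᵀ) zᵢ‖`. A query
vector with `(I - Q Qᵀ) zᵢ = 0` contributes `0`. -/
def slq {n k N : ℕ} (f : ℝ → ℝ) (A : Matrix (Fin n) (Fin n) ℝ) (Q : Matrix (Fin n) (Fin k) ℝ)
    (z : Fin N → Fin n → ℝ) (m : ℕ) : ℝ :=
  (1 / (N : ℝ)) * ∑ i, norm2 (compl Q *ᵥ z i) ^ 2 *
    lanczosQuadrature f A ((norm2 (compl Q *ᵥ z i))⁻¹ • (compl Q *ᵥ z i)) m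

end

end SLQ

namespace SLQ

section Spectral

variable {n : ℕ} {B : Matrix (Fin n) (Fin n) ℝ} (hB : B.IsHermitian)

theorem dotProduct_cfc_mulVec (f : ℝ → ℝ) (v : Fin n → ℝ) :
    v ⬝ᵥ (hB.cfc f *ᵥ v) =
      ∑ i, ((hB.eigenvectorBasis i).ofLp ⬝ᵥ v) ^ 2 * f (hB.eigenvalues i) := by
  rw [Matrix.IsHermitian.cfc, Unitary.conjStarAlgAut_apply, ← Matrix.mulVec_mulVec,
    ← Matrix.mulVec_mulVec, Matrix.dotProduct_mulVec, dotProduct]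
  refine Finset.sum_congr rfl fun i _ => ?_
  have h1 : (v ᵥ* (hB.eigenvectorUnitary : Matrix (Fin n) (Fin n) ℝ)) i
      = (hB.eigenvectorBasis i).ofLp ⬝ᵥ v := by
    rw [dotProduct_comm]; rfl
  have h2 : ((star hB.eigenvectorUnitary : Matrix (Fin n) (Fin n) ℝ) *ᵥ v) i
      = (hB.eigenvectorBasis i).ofLp ⬝ᵥ v := by
    simp [Matrix.mulVec, dotProduct]
  rw [h1, Matrix.mulVec_diagonal]
  simp only [h2, Function.comp_apply, RCLike.ofReal_real_eq_id, id]
  ring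

theorem cfc_polynomial_eval (p : Polynomial ℝ) :
    hB.cfc (fun x => p.eval x) = Polynomial.aeval B p := by
  rw [← hB.cfc_eq]
  exact cfc_polynomial p B hB.isSelfAdjoint

theorem sum_eigenvectorBasis_dotProduct_sq (v : Fin n → ℝ) :
    ∑ i, ((hB.eigenvectorBasis i).ofLp ⬝ᵥ v) ^ 2 = v ⬝ᵥ v := by
  have h := dotProduct_cfc_mulVec hB (fun x => (1 : Polynomial ℝ).eval x) v
  rw [cfc_polynomial_eval] at h
  simpa using h.symm

theorem dotProduct_mulVec_eq_sum (v : Fin n → ℝ) :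
    v ⬝ᵥ (B *ᵥ v) = ∑ i, ((hB.eigenvectorBasis i).ofLp ⬝ᵥ v) ^ 2 * hB.eigenvalues i := by
  have h := dotProduct_cfc_mulVec hB (fun x => (Polynomial.X : Polynomial ℝ).eval x) v
  rw [cfc_polynomial_eval] at h
  simpa using h

theorem dotProduct_mulVec_mem {a b : ℝ} (h : ∀ i, hB.eigenvalues i ∈ Set.Icc a b)
    (v : Fin n → ℝ) : v ⬝ᵥ (B *ᵥ v) ∈ Set.Icc (a * (v ⬝ᵥ v)) (b * (v ⬝ᵥ v)) := by
  rw [dotProduct_mulVec_eq_sum hB, ← sum_eigenvectorBasis_dotProduct_sq hB, Finset.mul_sum,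
    Finset.mul_sum]
  constructor <;> refine Finset.sum_le_sum fun i _ => ?_ <;> rw [mul_comm _ (_ ^ 2)]
  · exact mul_le_mul_of_nonneg_left (h i).1 (sq_nonneg _)
  · exact mul_le_mul_of_nonneg_left (h i).2 (sq_nonneg _)

theorem abs_dotProduct_cfc_sub_aeval_le {f : ℝ → ℝ} {p : Polynomial ℝ} {δ : ℝ}
    (h : ∀ i, |f (hB.eigenvalues i) - p.eval (hB.eigenvalues i)| ≤ δ) (v : Fin n → ℝ) :
    |v ⬝ᵥ (hB.cfc f *ᵥ v) - v ⬝ᵥ (Polynomial.aeval B p *ᵥ v)| ≤ δ * (v ⬝ᵥ v) := by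
  rw [← cfc_polynomial_eval hB, dotProduct_cfc_mulVec, dotProduct_cfc_mulVec,
    ← Finset.sum_sub_distrib, ← sum_eigenvectorBasis_dotProduct_sq hB, Finset.mul_sum]
  refine (Finset.abs_sum_le_sum_abs _ _).trans (Finset.sum_le_sum fun i _ => ?_)
  rw [← mul_sub, abs_mul, abs_of_nonneg (sq_nonneg _), mul_comm]
  exact mul_le_mul_of_nonneg_right (h i) (sq_nonneg _)

theorem eigenvalues_eq_dotProduct (i : Fin n) :
    hB.eigenvalues i
      = (hB.eigenvectorBasis i).ofLp ⬝ᵥ (B *ᵥ (hB.eigenvectorBasis i).ofLp) := by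
  simpa using hB.eigenvalues_eq i

theorem eigenvectorBasis_dotProduct_self (i : Fin n) :
    (hB.eigenvectorBasis i).ofLp ⬝ᵥ (hB.eigenvectorBasis i).ofLp = 1 := by
  have h := hB.eigenvectorBasis.orthonormal.1 i
  have h2 := EuclideanSpace.inner_eq_star_dotProduct (𝕜 := ℝ)
    (hB.eigenvectorBasis i) (hB.eigenvectorBasis i)
  rw [real_inner_self_eq_norm_sq, h] at h2
  simpa using h2.symm

theorem trace_cfc (f : ℝ → ℝ) : (hB.cfc f).trace = ∑ i, f (hB.eigenvalues i) := by
  rw [Matrix.IsHermitian.cfc, Unitary.conjStarAlgAut_apply, Matrix.trace_mul_comm, ← mul_assoc]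
  simp [Matrix.trace]

end Spectral

section Norm

variable {n : ℕ} (x : Fin n → ℝ)

theorem norm2_sq : norm2 x ^ 2 = x ⬝ᵥ x := by
  rw [norm2, EuclideanSpace.real_norm_sq_eq, dotProduct]
  exact Finset.sum_congr rfl fun i _ => sq _

theorem norm2_eq_zero {x : Fin n → ℝ} : norm2 x = 0 ↔ x = 0 := by
  simp [norm2]

theorem dotProduct_self_normalize {x : Fin n → ℝ} (h : norm2 x ≠ 0) :
    ((norm2 x)⁻¹ • x) ⬝ᵥ ((norm2 x)⁻¹ • x) = 1 := by
  rw [smul_dotProduct, dotProduct_smul, ← norm2_sq, smul_eq_mul, smul_eq_mul]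
  field_simp

end Norm

section Galerkin

variable {n j : ℕ} {A : Matrix (Fin n) (Fin n) ℝ} {V : Matrix (Fin n) (Fin (j + 1)) ℝ}
  {T : Matrix (Fin (j + 1)) (Fin (j + 1)) ℝ} {g : Fin n → ℝ}

theorem pow_apply_zero_of_hessenberg (hT : ∀ a b : Fin (j + 1), (b : ℕ) + 1 < a → T a b = 0)
    (i : ℕ) (a : Fin (j + 1)) (h : i < a) : (T ^ i) a 0 = 0 := by
  induction i generalizing a with
  | zero => exact Matrix.one_apply_ne (fun h0 => by simp [h0] at h)
  | succ i ih =>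
    rw [pow_succ', Matrix.mul_apply]
    refine Finset.sum_eq_zero fun b _ => ?_
    rcases lt_or_ge i (b : ℕ) with hb | hb
    · rw [ih b hb, mul_zero]
    · rw [hT a b (by omega), zero_mul]

theorem pow_mulVec_eq_of_krylov
    (hT : ∀ a b : Fin (j + 1), (b : ℕ) + 1 < a → T a b = 0)
    (hAV : A * V = V * T + Matrix.vecMulVec g (Pi.single (Fin.last j) 1))
    (i : ℕ) (hi : i ≤ j ∨ g = 0) :
    A ^ i *ᵥ (V *ᵥ Pi.single 0 1) = V *ᵥ (T ^ i *ᵥ Pi.single 0 1) := by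
  induction i with
  | zero => rw [pow_zero, pow_zero, Matrix.one_mulVec, Matrix.one_mulVec]
  | succ i ih =>
    rw [pow_succ', ← Matrix.mulVec_mulVec, ih (hi.imp_left (by omega)), Matrix.mulVec_mulVec _ A,
      hAV, Matrix.add_mulVec, pow_succ', ← Matrix.mulVec_mulVec, ← Matrix.mulVec_mulVec _ T,
      add_eq_left]
    rcases hi with hi | rfl
    · ext l
      have h0 := pow_apply_zero_of_hessenberg hT i (Fin.last j) (by simpa using hi)
      simp [Matrix.vecMulVec_apply, Matrix.mulVec, dotProduct, Pi.single_apply, h0]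
    · simp

theorem dotProduct_pow_mulVec_of_krylov (hA : A.IsSymm) (hV : Vᵀ * V = 1) (hg : Vᵀ *ᵥ g = 0)
    (hT : ∀ a b : Fin (j + 1), (b : ℕ) + 1 < a → T a b = 0)
    (hAV : A * V = V * T + Matrix.vecMulVec g (Pi.single (Fin.last j) 1))
    (i : ℕ) (hi : i ≤ 2 * j + 1 ∨ g = 0) :
    (V *ᵥ Pi.single 0 1) ⬝ᵥ (A ^ i *ᵥ (V *ᵥ Pi.single 0 1)) = (T ^ i) 0 0 := by
  have hVAV : Vᵀ * A * V = T := by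
    rw [Matrix.mul_assoc, hAV, Matrix.mul_add, ← Matrix.mul_assoc, hV, Matrix.one_mul,
      Matrix.mul_vecMulVec, hg,
      Matrix.zero_vecMulVec, add_zero]
  have hTs : T.IsSymm := by
    rw [← hVAV, Matrix.IsSymm, Matrix.transpose_mul, Matrix.transpose_mul, hA.eq,
      Matrix.transpose_transpose, Matrix.mul_assoc]
  obtain _ | i := i
  · rw [pow_zero, pow_zero, Matrix.one_mulVec, Matrix.dotProduct_mulVec, Matrix.vecMul_mulVec, hV]
    simp
  obtain ⟨a, b, hab, ha, hb⟩ : ∃ a b, a + 1 + b = i + 1 ∧ (a ≤ j ∨ g = 0) ∧ (b ≤ j ∨ g = 0) := by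
    rcases hi with hi | hi
    · exact ⟨min i j, i - min i j, by omega, Or.inl (by omega), Or.inl (by omega)⟩
    · exact ⟨i, 0, by omega, Or.inr hi, Or.inr hi⟩
  have hs : ∀ {l : ℕ} (B : Matrix (Fin l) (Fin l) ℝ), B.IsSymm → ∀ x y,
      x ⬝ᵥ (B *ᵥ y) = (B *ᵥ x) ⬝ᵥ y := by
    intro l B hB x y
    rw [Matrix.dotProduct_mulVec, ← Matrix.mulVec_transpose, hB.eq]
  have hVT : ∀ x y, (V *ᵥ x) ⬝ᵥ (A *ᵥ (V *ᵥ y)) = x ⬝ᵥ (T *ᵥ y) := by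
    intro x y
    rw [← hVAV, Matrix.mul_assoc, Matrix.dotProduct_mulVec x, ← Matrix.vecMul_vecMul,
      Matrix.vecMul_transpose, ← Matrix.dotProduct_mulVec, Matrix.mulVec_mulVec]
  have h00 : (Pi.single 0 1 : Fin (j + 1) → ℝ) ⬝ᵥ (T ^ (i + 1) *ᵥ Pi.single 0 1)
      = (T ^ (i + 1)) 0 0 := by simp
  rw [← h00, ← hab, pow_add, pow_add, pow_one, ← Matrix.mulVec_mulVec, ← Matrix.mulVec_mulVec,
    hs _ (hA.pow a), pow_mulVec_eq_of_krylov hT hAV a ha, pow_mulVec_eq_of_krylov hT hAV b hb,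
    hVT, ← hs _ (hTs.pow a), pow_add, pow_add, pow_one, ← Matrix.mulVec_mulVec,
    ← Matrix.mulVec_mulVec]

theorem dotProduct_aeval_mulVec_of_krylov (hA : A.IsSymm) (hV : Vᵀ * V = 1) (hg : Vᵀ *ᵥ g = 0)
    (hT : ∀ a b : Fin (j + 1), (b : ℕ) + 1 < a → T a b = 0)
    (hAV : A * V = V * T + Matrix.vecMulVec g (Pi.single (Fin.last j) 1))
    (p : Polynomial ℝ) (hp : p.natDegree ≤ 2 * j + 1 ∨ g = 0) :
    (V *ᵥ Pi.single 0 1) ⬝ᵥ (Polynomial.aeval A p *ᵥ (V *ᵥ Pi.single 0 1))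
      = (Polynomial.aeval T p) 0 0 := by
  rw [Polynomial.aeval_eq_sum_range, Polynomial.aeval_eq_sum_range, Matrix.sum_mulVec,
    dotProduct_sum, Matrix.sum_apply]
  refine Finset.sum_congr rfl fun i hi => ?_
  rw [Matrix.smul_mulVec, dotProduct_smul, Matrix.smul_apply,
    dotProduct_pow_mulVec_of_krylov hA hV hg hT hAV]
  have := Finset.mem_range.1 hi
  exact hp.imp_left (by omega)

end Galerkin

section Lanczos

variable {n : ℕ} {A : Matrix (Fin n) (Fin n) ℝ} {v : Fin n → ℝ}

theorem lanczosBeta_smul_cur_succ (k : ℕ) :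
    lanczosBeta A v k • (lanczosState A v (k + 1)).cur = (lanczosState A v k).residual A := by
  change norm2 _ • ((norm2 _)⁻¹ • _) = _
  by_cases h : norm2 ((lanczosState A v k).residual A) = 0
  · rw [h, zero_smul, norm2_eq_zero.1 h]
  · rw [smul_smul, mul_inv_cancel₀ h, one_smul]

theorem mulVec_lanczos_zero : A *ᵥ (lanczosState A v 0).cur =
    lanczosBeta A v 0 • (lanczosState A v 1).cur
      + lanczosAlpha A v 0 • (lanczosState A v 0).cur := by
  rw [lanczosBeta_smul_cur_succ, LanczosState.residual, lanczosAlpha]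
  simp [lanczosState]

theorem mulVec_lanczos_succ (k : ℕ) : A *ᵥ (lanczosState A v (k + 1)).cur =
    lanczosBeta A v (k + 1) • (lanczosState A v (k + 2)).cur
      + lanczosAlpha A v (k + 1) • (lanczosState A v (k + 1)).cur
      + lanczosBeta A v k • (lanczosState A v k).cur := by
  rw [lanczosBeta_smul_cur_succ, LanczosState.residual, lanczosAlpha]
  have h1 : (lanczosState A v (k + 1)).coupling = lanczosBeta A v k := rfl
  have h2 : (lanczosState A v (k + 1)).prev = (lanczosState A v k).cur := rfl
  rw [h1, h2]
  abel

theorem lanczos_orthonormal (hA : A.IsSymm) (hv : v ⬝ᵥ v = 1) (j : ℕ)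
    (hβ : ∀ i < j, lanczosBeta A v i ≠ 0) :
    ∀ a ≤ j, ∀ b ≤ j, (lanczosState A v a).cur ⬝ᵥ (lanczosState A v b).cur
      = if a = b then 1 else 0 := by
  have hs : ∀ x y, x ⬝ᵥ (A *ᵥ y) = y ⬝ᵥ (A *ᵥ x) := fun x y => by
    rw [Matrix.dotProduct_mulVec, ← Matrix.mulVec_transpose, hA.eq, dotProduct_comm]
  induction j with
  | zero =>
    intro a ha b hb
    obtain rfl : a = 0 := by omega
    obtain rfl : b = 0 := by omega
    exact hv
  | succ j ih =>
    have ih := ih fun i hi => hβ i (by omega)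
    have hself : (lanczosState A v (j + 1)).cur ⬝ᵥ (lanczosState A v (j + 1)).cur = 1 :=
      dotProduct_self_normalize (hβ j (by omega))
    have horth : ∀ a ≤ j, (lanczosState A v a).cur ⬝ᵥ (lanczosState A v (j + 1)).cur = 0 := by
      intro a ha
      have key : lanczosBeta A v j *
          ((lanczosState A v a).cur ⬝ᵥ (lanczosState A v (j + 1)).cur) = 0 := by
        have hα : ∀ k, (lanczosState A v k).cur ⬝ᵥ (A *ᵥ (lanczosState A v k).cur)
          = lanczosAlpha A v k := fun _ => rfl
        obtain _ | j := j
        · obtain rfl : a = 0 := by omega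
          have h := congrArg ((lanczosState A v 0).cur ⬝ᵥ ·) (mulVec_lanczos_zero (A := A) (v := v))
          simp only [dotProduct_add, dotProduct_smul, hα, ih 0 le_rfl 0 le_rfl, smul_eq_mul] at h
          simpa using h
        · have h := congrArg ((lanczosState A v a).cur ⬝ᵥ ·)
            (mulVec_lanczos_succ (A := A) (v := v) j)
          simp only [dotProduct_add, dotProduct_smul, smul_eq_mul,
            ih a ha (j + 1) le_rfl, ih a ha j (by omega)] at h
          rcases eq_or_lt_of_le ha with rfl | ha'
          · rw [hα] at h
            simpa using h
          · have h3 : (lanczosState A v a).cur ⬝ᵥ (A *ᵥ (lanczosState A v (j + 1)).cur)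
                = if a = j then lanczosBeta A v j else 0 := by
              rw [hs]
              obtain _ | a := a
              · rw [mulVec_lanczos_zero]
                simp only [dotProduct_add, dotProduct_smul, smul_eq_mul,
                  ih (j + 1) le_rfl 0 (by omega), ih (j + 1) le_rfl 1 (by omega)]
                grind
              · rw [mulVec_lanczos_succ]
                simp only [dotProduct_add, dotProduct_smul, smul_eq_mul,
                  ih (j + 1) le_rfl a (by omega), ih (j + 1) le_rfl (a + 1) (by omega),
                  ih (j + 1) le_rfl (a + 2) (by omega)]
                grind
            rw [h3] at h
            grind
      exact (mul_eq_zero.1 key).resolve_left (hβ j (by omega))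
    intro a ha b hb
    rcases Nat.lt_or_ge j a with ha' | ha' <;> rcases Nat.lt_or_ge j b with hb' | hb'
    · obtain rfl : a = j + 1 := by omega
      obtain rfl : b = j + 1 := by omega
      rw [hself, if_pos rfl]
    · obtain rfl : a = j + 1 := by omega
      rw [dotProduct_comm, horth b hb', if_neg (by omega)]
    · obtain rfl : b = j + 1 := by omega
      rw [horth a ha', if_neg (by omega)]
    · exact ih a ha' b hb'

/-- The matrix whose columns are the Lanczos vectors `q₀, …, q_j`. -/
noncomputable def lanczosBasis (A : Matrix (Fin n) (Fin n) ℝ) (v : Fin n → ℝ) (j : ℕ) :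
    Matrix (Fin n) (Fin (j + 1)) ℝ :=
  Matrix.of fun i a => (lanczosState A v a).cur i

theorem lanczosBasis_transpose_mul_self (hA : A.IsSymm) (hv : v ⬝ᵥ v = 1) {j : ℕ}
    (hβ : ∀ i < j, lanczosBeta A v i ≠ 0) :
    (lanczosBasis A v j)ᵀ * lanczosBasis A v j = 1 := by
  ext a b
  have h := lanczos_orthonormal hA hv j hβ a (by omega) b (by omega)
  rw [Matrix.one_apply]
  change (lanczosState A v a).cur ⬝ᵥ (lanczosState A v b).cur = _
  simpa [Fin.ext_iff] using h

theorem lanczosBasis_mulVec_single_zero (j : ℕ) :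
    lanczosBasis A v j *ᵥ Pi.single 0 1 = v := by
  rw [Matrix.mulVec_single_one]
  rfl

theorem lanczosBasis_transpose_mulVec_residual (hA : A.IsSymm) (hv : v ⬝ᵥ v = 1) {j : ℕ}
    (hβ : ∀ i < j, lanczosBeta A v i ≠ 0) :
    (lanczosBasis A v j)ᵀ *ᵥ ((lanczosState A v j).residual A) = 0 := by
  rw [← lanczosBeta_smul_cur_succ]
  by_cases h : lanczosBeta A v j = 0
  · rw [h, zero_smul, Matrix.mulVec_zero]
  · ext a
    have h' := lanczos_orthonormal hA hv (j + 1)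
      (fun i hi => by rcases Nat.lt_succ_iff_lt_or_eq.1 hi with hi | rfl; exacts [hβ i hi, h])
      a (by omega) (j + 1) le_rfl
    rw [if_neg (by omega)] at h'
    rw [Matrix.mulVec_smul, Pi.smul_apply]
    change _ • ((lanczosState A v a).cur ⬝ᵥ (lanczosState A v (j + 1)).cur) = 0
    rw [h', smul_zero]

theorem mul_lanczosBasis (j : ℕ) :
    A * lanczosBasis A v j
      = lanczosBasis A v j * jacobiMatrix (lanczosAlpha A v) (lanczosBeta A v) j
        + Matrix.vecMulVec ((lanczosState A v j).residual A) (Pi.single (Fin.last j) 1) := by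
  ext i b
  rw [Matrix.add_apply, Matrix.vecMulVec_apply, Matrix.mul_apply, Matrix.mul_apply]
  change (A *ᵥ (lanczosState A v b).cur) i = ∑ a : Fin (j + 1), (lanczosState A v a).cur i *
    jacobiMatrix (lanczosAlpha A v) (lanczosBeta A v) j a b + _
  rw [← lanczosBeta_smul_cur_succ]
  have hsum : ∑ a : Fin (j + 1), (lanczosState A v a).cur i *
      jacobiMatrix (lanczosAlpha A v) (lanczosBeta A v) j a b
      = ∑ a ∈ Finset.range (j + 1), ((if a = b then lanczosAlpha A v a * (lanczosState A v a).cur i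
          else 0) + (if a + 1 = b then lanczosBeta A v a * (lanczosState A v a).cur i else 0)
          + (if a = (b : ℕ) + 1 then lanczosBeta A v b * (lanczosState A v a).cur i else 0)) := by
    rw [Finset.sum_range]
    refine Finset.sum_congr rfl fun a _ => ?_
    simp only [jacobiMatrix, Matrix.of_apply]
    grind
  have hb := b.isLt
  rw [hsum, Finset.sum_add_distrib, Finset.sum_add_distrib, Finset.sum_ite_eq',
    Finset.sum_ite_eq', if_pos (Finset.mem_range.2 hb)]
  have hlast : (if (b : ℕ) + 1 ∈ Finset.range (j + 1) then
        lanczosBeta A v b * (lanczosState A v (b + 1)).cur i else 0)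
      + (lanczosBeta A v j • (lanczosState A v (j + 1)).cur) i
          * (Pi.single (Fin.last j) (1 : ℝ) : Fin (j + 1) → ℝ) b
      = lanczosBeta A v b * (lanczosState A v (b + 1)).cur i := by
    by_cases h : (b : ℕ) = j
    · obtain rfl : b = Fin.last j := Fin.ext h
      simp
    · have hne : b ≠ Fin.last j := fun h' => h (by simp [h'])
      rw [if_pos (Finset.mem_range.2 (by omega)), Pi.single_eq_of_ne hne, mul_zero, add_zero]
  rw [add_assoc, hlast]
  obtain ⟨_ | b, hb⟩ := b
  · rw [mulVec_lanczos_zero]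
    simp [add_comm]
  · rw [mulVec_lanczos_succ]
    simp only [Nat.add_right_cancel_iff, Finset.sum_ite_eq', Pi.add_apply, Pi.smul_apply,
      smul_eq_mul]
    rw [if_pos (Finset.mem_range.2 (by omega))]
    ring

theorem lanczosLast_mem (m : ℕ) :
    lanczosLast A v m = m ∨ lanczosBeta A v (lanczosLast A v m) = 0 :=
  Nat.sInf_mem (s := {j : ℕ | j = m ∨ lanczosBeta A v j = 0}) ⟨m, Or.inl rfl⟩

theorem lanczosBeta_ne_zero_of_lt_lanczosLast {m i : ℕ} (h : i < lanczosLast A v m) :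
    lanczosBeta A v i ≠ 0 := fun h0 =>
  Nat.notMem_of_lt_sInf (s := {j : ℕ | j = m ∨ lanczosBeta A v j = 0}) h (Or.inr h0)

theorem jacobiQuadrature_eq (f : ℝ → ℝ) (α β : ℕ → ℝ) (j : ℕ) :
    jacobiQuadrature f α β j = (Pi.single 0 1 : Fin (j + 1) → ℝ) ⬝ᵥ
      ((jacobiMatrix_isHermitian α β j).cfc f *ᵥ Pi.single 0 1) := by
  rw [dotProduct_cfc_mulVec, jacobiQuadrature]
  simp

/-- If `f` is uniformly within `δ` of a polynomial of degree at most `2m + 1` on an interval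
containing the spectrum, then the `(m+1)`-step Lanczos quadrature has error at most `2δ`. -/
theorem abs_dotProduct_cfc_sub_lanczosQuadrature_le (hA : A.IsHermitian) (hv : v ⬝ᵥ v = 1)
    {a b δ : ℝ} (hab : ∀ i, hA.eigenvalues i ∈ Set.Icc a b) {f : ℝ → ℝ} {p : Polynomial ℝ}
    {m : ℕ} (hp : p.natDegree ≤ 2 * m + 1) (hfp : ∀ x ∈ Set.Icc a b, |f x - p.eval x| ≤ δ) :
    |v ⬝ᵥ (hA.cfc f *ᵥ v) - lanczosQuadrature f A v m| ≤ 2 * δ := by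
  have hAs : A.IsSymm := by simpa [Matrix.IsHermitian, Matrix.IsSymm] using hA
  set j := lanczosLast A v m with hj
  have hβ : ∀ i < j, lanczosBeta A v i ≠ 0 := fun i hi => lanczosBeta_ne_zero_of_lt_lanczosLast hi
  set α' := lanczosAlpha A v
  set β' := lanczosBeta A v with hβ'
  set T := jacobiMatrix α' β' j with hTdef
  have hT : T.IsHermitian := jacobiMatrix_isHermitian α' β' j
  set V := lanczosBasis A v j with hVdef
  have hV : Vᵀ * V = 1 := lanczosBasis_transpose_mul_self hAs hv hβ
  have hg := lanczosBasis_transpose_mulVec_residual hAs hv hβ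
  have hAV : A * V = V * T + _ := mul_lanczosBasis j
  have hhess : ∀ a b : Fin (j + 1), (b : ℕ) + 1 < a → T a b = 0 := by
    intro a b h
    simp only [hTdef, jacobiMatrix, Matrix.of_apply]
    grind
  have hexact : v ⬝ᵥ (Polynomial.aeval A p *ᵥ v) = (Polynomial.aeval T p) 0 0 := by
    have h := dotProduct_aeval_mulVec_of_krylov hAs hV hg hhess hAV p (by
      rcases lanczosLast_mem (A := A) (v := v) m with h | h
      · left; rw [hj, h]; exact hp
      · right; exact norm2_eq_zero.1 h)
    rwa [lanczosBasis_mulVec_single_zero] at h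
  have hVAV : Vᵀ * (A * V) = T := by
    rw [hAV, Matrix.mul_add, ← Matrix.mul_assoc, hV, Matrix.one_mul,
      Matrix.mul_vecMulVec, hg,
      Matrix.zero_vecMulVec, add_zero]
  have hTab : ∀ i, hT.eigenvalues i ∈ Set.Icc a b := by
    intro i
    set u := (hT.eigenvectorBasis i).ofLp with hu
    have hu1 : u ⬝ᵥ u = 1 := eigenvectorBasis_dotProduct_self hT i
    have h1 : (V *ᵥ u) ⬝ᵥ (V *ᵥ u) = 1 := by
      rw [Matrix.dotProduct_mulVec, Matrix.vecMul_mulVec, hV, Matrix.vecMul_one, hu1]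
    have h2 : (V *ᵥ u) ⬝ᵥ (A *ᵥ (V *ᵥ u)) = hT.eigenvalues i := by
      rw [eigenvalues_eq_dotProduct, ← hu, Matrix.mulVec_mulVec, Matrix.dotProduct_mulVec,
        Matrix.vecMul_mulVec, hVAV, Matrix.dotProduct_mulVec]
    have h3 := dotProduct_mulVec_mem hA hab (V *ᵥ u)
    rwa [h1, h2, mul_one, mul_one] at h3
  have e1 := abs_dotProduct_cfc_sub_aeval_le hA (fun i => hfp _ (hab i)) v
  have e2 := abs_dotProduct_cfc_sub_aeval_le hT (fun i => hfp _ (hTab i)) (Pi.single 0 1)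
  have hq : lanczosQuadrature f A v m = Pi.single 0 1 ⬝ᵥ (hT.cfc f *ᵥ Pi.single 0 1) :=
    jacobiQuadrature_eq f α' β' j
  have h00 : (Pi.single 0 1 : Fin (j + 1) → ℝ) ⬝ᵥ (Polynomial.aeval T p *ᵥ Pi.single 0 1)
      = (Polynomial.aeval T p) 0 0 := by simp
  rw [← hq, h00, ← hexact] at e2
  rw [hv] at e1
  simp only [single_one_dotProduct, Pi.single_eq_same] at e2
  rw [abs_le] at *
  constructor <;> linarith [e1.1, e1.2, e2.1, e2.2]

end Lanczos

section LogSeries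

theorem hasSum_log_one_add_cos {r : ℝ} (hr0 : 0 ≤ r) (hr : r < 1) (θ : ℝ) :
    HasSum (fun k : ℕ => 2 * (-1) ^ k * r ^ (k + 1) / (k + 1) * Real.cos ((k + 1) * θ))
      (Real.log (1 + 2 * r * Real.cos θ + r ^ 2)) := by
  set z : ℂ := -(r * Complex.exp (θ * Complex.I)) with hz
  have hn : ‖z‖ < 1 := by
    rw [hz, norm_neg, norm_mul, Complex.norm_exp_ofReal_mul_I]
    simpa [abs_of_nonneg hr0] using hr
  have hs := Complex.hasSum_re (Complex.hasSum_taylorSeries_neg_log' hn)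
  have hs2 := hs.mul_left (-2)
  have hnorm : ‖1 - z‖ ^ 2 = 1 + 2 * r * Real.cos θ + r ^ 2 := by
    rw [← Complex.normSq_eq_norm_sq, hz, Complex.exp_mul_I, Complex.normSq_apply,
      ← Complex.ofReal_cos, ← Complex.ofReal_sin]
    simp [-Complex.ofReal_cos, -Complex.ofReal_sin]
    linear_combination r ^ 2 * Real.sin_sq_add_cos_sq θ
  have hlog : -2 * (-Complex.log (1 - z)).re = Real.log (1 + 2 * r * Real.cos θ + r ^ 2) := by
    rw [← hnorm, Complex.neg_re, Complex.log_re, Real.log_pow]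
    push_cast
    ring
  rw [hlog] at hs2
  have hterm : ∀ k : ℕ, 2 * (-1) ^ k * r ^ (k + 1) / (k + 1) * Real.cos ((k + 1) * θ)
      = -2 * (z ^ (k + 1) / (k + 1)).re := by
    intro k
    have : z ^ (k + 1) / (k + 1)
        = (((-1) ^ (k + 1) * r ^ (k + 1) / (k + 1) : ℝ) : ℂ)
          * Complex.exp ((((k + 1) * θ : ℝ) : ℂ) * Complex.I) := by
      rw [hz, neg_pow, mul_pow, ← Complex.exp_nat_mul]
      push_cast
      rw [← mul_assoc ((k : ℂ) + 1)]
      ring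
    rw [this, Complex.re_ofReal_mul, Complex.exp_ofReal_mul_I_re]
    ring
  simpa only [hterm] using hs2

open Polynomial in
/-- The Chebyshev expansion of `y ↦ log (1 + 2 r y + r²)`, truncated at degree `d`. -/
noncomputable def chebyshevLog (r : ℝ) (d : ℕ) : ℝ[X] :=
  ∑ k ∈ Finset.range d, C (2 * (-1) ^ k * r ^ (k + 1) / (k + 1)) * Chebyshev.T ℝ ((k + 1 : ℕ) : ℤ)

theorem natDegree_chebyshevLog_le (r : ℝ) (d : ℕ) : (chebyshevLog r d).natDegree ≤ d := by
  refine Polynomial.natDegree_sum_le_of_forall_le _ _ fun k hk => ?_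
  refine (Polynomial.natDegree_C_mul_le _ _).trans ?_
  rw [Polynomial.Chebyshev.natDegree_T, Int.natAbs_natCast]
  have := Finset.mem_range.1 hk
  omega

theorem abs_log_sub_chebyshevLog_le {r : ℝ} (hr0 : 0 ≤ r) (hr : r < 1) (d : ℕ) {y : ℝ}
    (hy : y ∈ Set.Icc (-1) 1) :
    |Real.log (1 + 2 * r * y + r ^ 2) - (chebyshevLog r d).eval y|
      ≤ 2 * r ^ (d + 1) / (1 - r) := by
  obtain ⟨θ, rfl⟩ : ∃ θ, Real.cos θ = y := ⟨Real.arccos y, Real.cos_arccos hy.1 hy.2⟩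
  have hs := (hasSum_log_one_add_cos hr0 hr θ).tendsto_sum_nat
  have he : (chebyshevLog r d).eval (Real.cos θ) = ∑ k ∈ Finset.range d,
      2 * (-1) ^ k * r ^ (k + 1) / (k + 1) * Real.cos ((k + 1) * θ) := by
    rw [chebyshevLog, Polynomial.eval_finsetSum]
    refine Finset.sum_congr rfl fun k _ => ?_
    rw [Polynomial.eval_mul, Polynomial.eval_C, Polynomial.Chebyshev.T_real_cos]
    push_cast
    rfl
  rw [he, abs_sub_comm, ← Real.dist_eq]
  refine (dist_le_of_le_geometric_of_tendsto (C := 2 * r) r hr (fun k => ?_) hs d).trans_eq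
    (by ring)
  rw [Real.dist_eq, Finset.sum_range_succ, sub_add_cancel_left, abs_neg, abs_mul, abs_div, abs_mul,
    abs_mul, abs_pow, abs_pow, abs_neg, abs_one, one_pow, abs_of_nonneg hr0, mul_one,
    abs_of_pos (two_pos), abs_of_pos (by positivity : (0 : ℝ) < k + 1)]
  calc 2 * r ^ (k + 1) / (k + 1) * |Real.cos ((k + 1) * θ)|
      ≤ 2 * r ^ (k + 1) / 1 * 1 := by
        gcongr
        · linarith [(Nat.cast_nonneg k : (0 : ℝ) ≤ k)]
        · exact Real.abs_cos_le_one _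
    _ = 2 * r * r ^ k := by ring

open Polynomial in
theorem exists_polynomial_near_log {a b : ℝ} (ha : 0 < a) (hab : a < b) (d : ℕ) :
    ∃ p : ℝ[X], p.natDegree ≤ d ∧ ∀ x ∈ Set.Icc a b, |Real.log x - p.eval x| ≤
      2 * ((√b - √a) / (√b + √a)) ^ (d + 1) / (1 - (√b - √a) / (√b + √a)) := by
  have hb : 0 < b := ha.trans hab
  have hsa : 0 < √a := Real.sqrt_pos.2 ha
  have hsab : √a < √b := Real.sqrt_lt_sqrt ha.le hab
  have hea : √a ^ 2 = a := Real.sq_sqrt ha.le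
  have heb : √b ^ 2 = b := Real.sq_sqrt hb.le
  have hba : 0 < b - a := sub_pos.2 hab
  set r := (√b - √a) / (√b + √a) with hr
  have hr0 : 0 ≤ r := div_nonneg (by linarith) (by linarith)
  have hr1 : r < 1 := by rw [hr, div_lt_one (by linarith)]; linarith
  set K := (√a + √b) ^ 2 / 4 with hK
  have hK0 : 0 < K := by positivity
  refine ⟨C (Real.log K) + (chebyshevLog r d).comp (C (2 / (b - a)) * X - C ((a + b) / (b - a))),
    ?_, fun x hx => ?_⟩
  · refine (natDegree_add_le _ _).trans (max_le (by simp) (natDegree_comp_le.trans ?_))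
    refine (Nat.mul_le_mul (natDegree_chebyshevLog_le r d) ?_).trans_eq (mul_one d)
    refine (natDegree_sub_le _ _).trans (max_le ?_ (by simp))
    exact (natDegree_C_mul_le _ _).trans natDegree_X_le
  · set y := 2 / (b - a) * x - (a + b) / (b - a) with hy
    have hye : y * (b - a) = 2 * x - (a + b) := by rw [hy]; field_simp
    have hy1 : y ∈ Set.Icc (-1) 1 := by
      constructor
      · by_contra! h
        nlinarith [hx.1]
      · by_contra! h
        nlinarith [hx.2]
    have hx0 : x = K * (1 + 2 * r * y + r ^ 2) := by
      have h1 : K * (2 * r) = (b - a) / 2 := by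
        rw [hK, hr, ← heb, ← hea]
        simp only [Real.sqrt_sq hsa.le, Real.sqrt_sq (hsa.trans hsab).le]
        field_simp
        ring
      have h2 : K * (1 + r ^ 2) = (a + b) / 2 := by
        rw [hK, hr, ← heb, ← hea]
        simp only [Real.sqrt_sq hsa.le, Real.sqrt_sq (hsa.trans hsab).le]
        field_simp
        ring
      linear_combination -h1 * y - h2 - hye / 2
    have hxp : 0 < x := ha.trans_le hx.1
    have hne : 1 + 2 * r * y + r ^ 2 ≠ 0 := fun h => by
      rw [h, mul_zero] at hx0; exact hxp.ne' hx0
    have hlog : Real.log x = Real.log K + Real.log (1 + 2 * r * y + r ^ 2) := by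
      rw [← Real.log_mul hK0.ne' hne, ← hx0]
    have := abs_log_sub_chebyshevLog_le hr0 hr1 d hy1
    simpa [hlog, ← hy] using this

end LogSeries

section Projector

variable {n k : ℕ} {Q : Matrix (Fin n) (Fin k) ℝ}

theorem compl_isSymm : (compl Q).IsSymm := by
  simp [compl, Matrix.IsSymm, Matrix.transpose_mul]

theorem dotProduct_compl_mulVec_self_le (hQ : Qᵀ * Q = 1) (z : Fin n → ℝ) :
    (compl Q *ᵥ z) ⬝ᵥ (compl Q *ᵥ z) ≤ z ⬝ᵥ z := by
  have h1 : (compl Q)ᵀ * compl Q = compl Q := by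
    have : Q * Qᵀ * (Q * Qᵀ) = Q * Qᵀ := by
      rw [Matrix.mul_assoc, ← Matrix.mul_assoc Qᵀ, hQ, Matrix.one_mul]
    rw [compl_isSymm.eq, compl, mul_sub, sub_mul, sub_mul, this]
    simp
  have h2 : (compl Q *ᵥ z) ⬝ᵥ (compl Q *ᵥ z) = z ⬝ᵥ z - (Qᵀ *ᵥ z) ⬝ᵥ (Qᵀ *ᵥ z) := by
    rw [Matrix.dotProduct_mulVec, ← Matrix.vecMul_transpose, Matrix.vecMul_vecMul, h1,
      ← Matrix.dotProduct_mulVec, compl, Matrix.sub_mulVec, Matrix.one_mulVec, dotProduct_sub,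
      ← Matrix.mulVec_mulVec, Matrix.dotProduct_mulVec z, Matrix.mulVec_transpose]
  rw [h2]
  have : 0 ≤ (Qᵀ *ᵥ z) ⬝ᵥ (Qᵀ *ᵥ z) := by rw [← norm2_sq]; positivity
  linarith

theorem dotProduct_Delta_mulVec (f : ℝ → ℝ) {A : Matrix (Fin n) (Fin n) ℝ} (hA : A.IsHermitian)
    (z : Fin n → ℝ) :
    z ⬝ᵥ (Delta f hA Q *ᵥ z) = (compl Q *ᵥ z) ⬝ᵥ (hA.cfc f *ᵥ (compl Q *ᵥ z)) := by
  rw [Delta, matFun, ← Matrix.mulVec_mulVec, ← Matrix.mulVec_mulVec, Matrix.dotProduct_mulVec z,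
    ← Matrix.mulVec_transpose, compl_isSymm.eq]

end Projector

/-- The stochastic Lanczos quadrature estimator differs from the Hutchinson estimator by at most
`2δn`, if `f` is within `δ` of a polynomial of degree at most `2m + 1` on an interval that contains
the spectrum. -/
theorem abs_hutchinson_sub_slq_le {n k N : ℕ} {A : Matrix (Fin n) (Fin n) ℝ} (hA : A.IsHermitian)
    {Q : Matrix (Fin n) (Fin k) ℝ} (hQ : Qᵀ * Q = 1) {z : Fin N → Fin n → ℝ}
    (hz : ∀ i j, z i j = 1 ∨ z i j = -1) {a b δ : ℝ} (hδ : 0 ≤ δ)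
    (hab : ∀ i, hA.eigenvalues i ∈ Set.Icc a b) {f : ℝ → ℝ} {p : Polynomial ℝ} {m : ℕ}
    (hp : p.natDegree ≤ 2 * m + 1) (hfp : ∀ x ∈ Set.Icc a b, |f x - p.eval x| ≤ δ) :
    |hutchinson (Delta f hA Q) z - slq f A Q z m| ≤ 2 * δ * n := by
  have hterm : ∀ i, |z i ⬝ᵥ (Delta f hA Q *ᵥ z i) - norm2 (compl Q *ᵥ z i) ^ 2 *
      lanczosQuadrature f A ((norm2 (compl Q *ᵥ z i))⁻¹ • (compl Q *ᵥ z i)) m| ≤ 2 * δ * n := by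
    intro i
    have hzi : z i ⬝ᵥ z i = n := by
      have : ∀ j, z i j * z i j = 1 := fun j => by rcases hz i j with h | h <;> rw [h] <;> norm_num
      simp [dotProduct, this]
    have hle := dotProduct_compl_mulVec_self_le hQ (z i)
    rw [hzi] at hle
    rw [dotProduct_Delta_mulVec]
    set w := compl Q *ᵥ z i with hw
    rw [← norm2_sq] at hle
    by_cases h : norm2 w = 0
    · rw [norm2_eq_zero.1 h]
      simp [norm2]
      positivity
    · have hv := dotProduct_self_normalize h
      have hq := abs_dotProduct_cfc_sub_lanczosQuadrature_le hA hv hab hp hfp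
      have hwv : w ⬝ᵥ (hA.cfc f *ᵥ w) = norm2 w ^ 2 *
          (((norm2 w)⁻¹ • w) ⬝ᵥ (hA.cfc f *ᵥ ((norm2 w)⁻¹ • w))) := by
        rw [Matrix.mulVec_smul, smul_dotProduct, dotProduct_smul, smul_eq_mul, smul_eq_mul]
        field_simp
      rw [hwv, ← mul_sub, abs_mul, abs_of_nonneg (sq_nonneg _), mul_comm]
      exact mul_le_mul hq hle (sq_nonneg _) (by positivity)
  rw [hutchinson, slq, ← mul_sub, ← Finset.sum_sub_distrib, abs_mul,
    abs_of_nonneg (by positivity)]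
  have hsum := (Finset.abs_sum_le_sum_abs _ _).trans
    (Finset.sum_le_sum (s := Finset.univ) fun i _ => hterm i)
  rw [Finset.sum_const, Finset.card_univ, Fintype.card_fin, nsmul_eq_mul] at hsum
  refine (mul_le_mul_of_nonneg_left hsum (by positivity)).trans ?_
  rcases eq_or_ne N 0 with rfl | hN
  · simp
    positivity
  · refine le_of_eq ?_
    field_simp

theorem sub_one_mul_add_le_trace_cfc {n : ℕ} {A : Matrix (Fin n) (Fin n) ℝ} (hA : A.IsHermitian)
    {f : ℝ → ℝ} {a b : ℝ} (ha : ∀ i, f a ≤ f (hA.eigenvalues i)) (hb : b ∈ spectrum ℝ A) :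
    ((n : ℝ) - 1) * f a + f b ≤ (hA.cfc f).trace := by
  rw [hA.spectrum_real_eq_range_eigenvalues] at hb
  obtain ⟨i, rfl⟩ := hb
  rw [trace_cfc, ← Finset.sum_erase_add _ _ (Finset.mem_univ i)]
  have h := Finset.card_nsmul_le_sum (Finset.univ.erase i) (fun i => f (hA.eigenvalues i)) (f a)
    (fun j _ => ha j)
  rw [Finset.card_erase_of_mem (Finset.mem_univ i), Finset.card_univ, Fintype.card_fin,
    nsmul_eq_mul, Nat.cast_sub (Fin.pos i), Nat.cast_one] at h
  linarith

/-- With `ρ` the parameter of the Bernstein ellipse through `a / 2` with foci `a < b`, the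
convergence rate `(√b - √a) / (√b + √a)` of the Chebyshev expansion of the logarithm is at most
`ρ⁻¹`. -/
theorem one_lt_bernstein_and_chebyshev_rate_le {a b : ℝ} (ha : 0 < a) (hab : a < b) :
    1 < (b + √(2 * b * a - a ^ 2)) / (b - a) ∧
      (√b - √a) / (√b + √a) ≤ ((b + √(2 * b * a - a ^ 2)) / (b - a))⁻¹ := by
  have hb : 0 < b := ha.trans hab
  have hba : 0 < b - a := sub_pos.2 hab
  have hsa : 0 < √a := Real.sqrt_pos.2 ha
  have hsab : √a < √b := Real.sqrt_lt_sqrt ha.le hab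
  have hea : √a ^ 2 = a := Real.sq_sqrt ha.le
  have heb : √b ^ 2 = b := Real.sq_sqrt hb.le
  set s := √(2 * b * a - a ^ 2) with hs
  have hs0 : 0 ≤ s := Real.sqrt_nonneg _
  have hes : s ^ 2 = 2 * b * a - a ^ 2 := Real.sq_sqrt (by nlinarith)
  refine ⟨by rw [one_lt_div hba]; linarith, ?_⟩
  have hsb : s ≤ b := abs_le_of_sq_le_sq' (by nlinarith [sq_nonneg (b - a)]) hb.le |>.2
  have has : a + s ≤ 2 * (√a * √b) := by
    refine abs_le_of_sq_le_sq' ?_ (by positivity) |>.2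
    have : (2 * (√a * √b)) ^ 2 = 4 * (a * b) := by rw [mul_pow, mul_pow, hea, heb]; norm_num
    rw [this]
    nlinarith
  have h1 : (√b - √a) / (√b + √a) = (a + b - 2 * (√a * √b)) / (b - a) := by
    rw [div_eq_div_iff (by linarith) hba.ne']
    linear_combination 2 * √a * heb + 2 * √b * hea
  have h2 : ((b + s) / (b - a))⁻¹ = (b - s) / (b - a) := by
    rw [inv_div, div_eq_div_iff (by linarith) hba.ne']
    linear_combination hes
  rw [h1, h2]
  exact div_le_div_of_nonneg_right (by linarith) hba.le

end SLQ

theorem theorem4p1 {n k N : ℕ} (hN : 1 ≤ N)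
    (A : Matrix (Fin n) (Fin n) ℝ) (hA : A.PosDef)
    (lmin lmax : ℝ) (hmin : IsLeast (spectrum ℝ A) lmin) (hmax : IsGreatest (spectrum ℝ A) lmax)
    (h1 : 1 ≤ lmin)
    (Q : Matrix (Fin n) (Fin k) ℝ) (hQ : Qᵀ * Q = 1)
    (z : Fin N → Fin n → ℝ) (hz : ∀ i j, z i j = 1 ∨ z i j = -1)
    (ε : ℝ) (hε : 0 < ε)
    (C M ρ : ℝ)
    (hC : C = ((n : ℝ) - 1) * Real.log lmin + Real.log lmax)
    (hM : M = |Real.log (lmin / 2)| + Real.pi)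
    (hρ : ρ = (lmax + Real.sqrt (2 * lmax * lmin - lmin ^ 2)) / (lmax - lmin))
    (m : ℕ)
    (hm : lmin < lmax →
      (1 / 2) * Real.log (16 * n * M / (C * ε * (ρ ^ 2 - ρ))) / Real.log ρ ≤ (m : ℝ)) :
    |SLQ.hutchinson (SLQ.Delta Real.log hA.isHermitian Q) z - SLQ.slq Real.log A Q z m|
      ≤ ε / 4 * |(SLQ.matFun Real.log hA.isHermitian).trace| := by
  have hspec : ∀ i, hA.isHermitian.eigenvalues i ∈ Set.Icc lmin lmax := fun i =>
    ⟨hmin.2 (hA.isHermitian.eigenvalues_mem_spectrum_real i),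
      hmax.2 (hA.isHermitian.eigenvalues_mem_spectrum_real i)⟩
  have hl0 : 0 < lmin := one_pos.trans_le h1
  rcases eq_or_lt_of_le (hmin.2 hmax.1) with heq | hlt
  · have h := SLQ.abs_hutchinson_sub_slq_le hA.isHermitian hQ hz (m := m) le_rfl hspec
      (f := Real.log) (p := Polynomial.C (Real.log lmin)) (by simp) (fun x hx => by
        obtain rfl : x = lmin := le_antisymm (hx.2.trans_eq heq.symm) hx.1
        simp)
    refine h.trans ?_
    rw [mul_zero, zero_mul]
    positivity
  obtain ⟨hρ1, hrate⟩ := SLQ.one_lt_bernstein_and_chebyshev_rate_le hl0 hlt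
  rw [← hρ] at hρ1 hrate
  obtain ⟨p, hp, hfp⟩ := SLQ.exists_polynomial_near_log hl0 hlt (2 * m + 1)
  set r := (√lmax - √lmin) / (√lmax + √lmin) with hr
  have hr0 : 0 ≤ r :=
    div_nonneg (sub_nonneg.2 (Real.sqrt_le_sqrt hlt.le)) (by positivity)
  have hρ0 : 0 < ρ := one_pos.trans hρ1
  have hρi : ρ⁻¹ < 1 := inv_lt_one_of_one_lt₀ hρ1
  have hn : 1 ≤ n := by
    obtain ⟨i, -⟩ := hA.isHermitian.spectrum_real_eq_range_eigenvalues ▸ hmax.1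
    exact Fin.pos i
  have hn' : (1 : ℝ) ≤ n := by exact_mod_cast hn
  have hC0 : 0 < C := by
    rw [hC]
    have := Real.log_pos (h1.trans_lt hlt)
    have := mul_nonneg (sub_nonneg.2 hn') (Real.log_nonneg h1)
    linarith
  have hM1 : 1 ≤ M := by
    rw [hM]
    have := Real.pi_gt_three
    have := abs_nonneg (Real.log (lmin / 2))
    linarith
  have hρρ : 0 < ρ ^ 2 - ρ := by nlinarith
  have htr : C ≤ (SLQ.matFun Real.log hA.isHermitian).trace := by
    rw [hC]
    exact SLQ.sub_one_mul_add_le_trace_cfc hA.isHermitian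
      (fun i => Real.log_le_log hl0 (hspec i).1) hmax.1
  have hpow : 16 * n * M / (C * ε * (ρ ^ 2 - ρ)) ≤ ρ ^ (2 * m) := by
    have h := hm hlt
    rw [div_le_iff₀ (Real.log_pos hρ1)] at h
    rw [← Real.log_le_log_iff (by positivity) (by positivity), Real.log_pow]
    push_cast
    linarith
  have hδ : 2 * r ^ (2 * m + 1 + 1) / (1 - r) ≤ 2 / (ρ ^ (2 * m) * (ρ ^ 2 - ρ)) := by
    calc 2 * r ^ (2 * m + 1 + 1) / (1 - r)
        ≤ 2 * ρ⁻¹ ^ (2 * m + 1 + 1) / (1 - ρ⁻¹) := by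
          gcongr
      _ = 2 / (ρ ^ (2 * m) * (ρ ^ 2 - ρ)) := by
          rw [show ρ ^ (2 * m) * (ρ ^ 2 - ρ) = ρ ^ (2 * m + 1 + 1) * (1 - ρ⁻¹) by
              field_simp; ring,
            inv_pow, ← div_eq_mul_inv, div_div]
  have hδ0 : 0 ≤ 2 * r ^ (2 * m + 1 + 1) / (1 - r) :=
    div_nonneg (by positivity) (by linarith)
  refine (SLQ.abs_hutchinson_sub_slq_le hA.isHermitian hQ hz hδ0 hspec hp hfp).trans ?_
  rw [div_le_iff₀ (by positivity)] at hpow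
  calc 2 * (2 * r ^ (2 * m + 1 + 1) / (1 - r)) * n
      ≤ 2 * (2 / (ρ ^ (2 * m) * (ρ ^ 2 - ρ))) * n := by gcongr
    _ ≤ ε / 4 * C := by
        rw [show 2 * (2 / (ρ ^ (2 * m) * (ρ ^ 2 - ρ))) * n
          = 4 * n / (ρ ^ (2 * m) * (ρ ^ 2 - ρ)) by ring, div_le_iff₀ (by positivity)]
        nlinarith [mul_le_mul_of_nonneg_left hM1 (by positivity : (0 : ℝ) ≤ 16 * n)]
    _ ≤ ε / 4 * |(SLQ.matFun Real.log hA.isHermitian).trace| := by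
        gcongr
        exact htr.trans (le_abs_self _)
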